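/- Let $\Gamma$ be a finite simplicial graph with vertex set $I$, and let $W(\Gamma)$ be the right-angled Coxeter group with generating set $I$ and relations $i^2=1$ for $i\in I$ and $ij=ji$ for every edge $\{i,j\}$ of $\Gamma$. A word in the alphabet $I$ is reduced if no shorter word represents the same element of $W(\Gamma)$. A chamber system over $I$ is a set of chambers with an equivalence relation, called $i$-adjacency, for each $i\in I$. A gallery of type $i_1\cdots i_k$ from $c$ to $d$ is a sequence of chambers $c=c_0,c_1,\dots,c_k=d$ such that $c_{j-1}$ and $c_j$ are distinct and $i_j$-adjacent for $1\le j\le k$. For $J\subset I$, the $J$-residue of a chamber $c$ is the set of all chambers that can be joined to $c$ by a gallery whose type is a word in $J$; a residue of rank $1$ is a $\{i\}$-residue with $i\in I$. A right-angled $\Gamma$-building is a nonempty chamber system over $I$ such that every $i$-adjacency class has at least two elements for every $i\in I$, together with a function $\delta$ from pairs of chambers to $W(\Gamma)$ such that, for every reduced word $f$ and all chambers $c,d$, there is a gallery of type $f$ from $c$ to $d$ if and only if $\delta(c,d)$ is the element of $W(\Gamma)$ represented by $f$. **Corollary.** Let $\mathcal B_1$ and $\mathcal B_2$ be two right-angled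 $\Gamma$-buildings all of whose rank-$1$ residues are countably infinite. Then $\mathcal B_1$ and $\mathcal B_2$ are isomorphic as buildings: there is a bijection between their sets of chambers which, for every $i\in I$, preserves $i$-adjacency in both directions, and which preserves the $W(\Gamma)$-valued distance $\delta$. -/

import Mathlib

namespace RightAngled

universe u v

open Classical in
/-- The right-angled Coxeter matrix of a simplicial graph `Γ`: `m(i,i) = 1`, `m(i,j) = 2` if `i` and
`j` span an edge, and `m(i,j) = ∞` (encoded by `0`, as in Mathlib) otherwise. -/
noncomputable def coxeterMatrix {I : Type u} (Γ : SimpleGraph I) : CoxeterMatrix I where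
  M := Matrix.of fun i j => if i = j then 1 else if Γ.Adj i j then 2 else 0
  isSymm := by
    ext i j
    simp only [Matrix.transpose_apply, Matrix.of_apply, eq_comm (a := j) (b := i),
      Γ.adj_comm j i]
  diagonal := by simp
  off_diagonal := by
    intro i j hij
    by_cases h : Γ.Adj i j <;> simp [hij, h]

/-- The right-angled Coxeter group `W(Γ)`. -/
abbrev CoxGroup {I : Type u} (Γ : SimpleGraph I) : Type u :=
  (coxeterMatrix Γ).Group

/-- `W(Γ)` with its standard generating set, as a Coxeter system. -/
noncomputable abbrev coxSystem {I : Type u} (Γ : SimpleGraph I) :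
    CoxeterSystem (coxeterMatrix Γ) (CoxGroup Γ) :=
  (coxeterMatrix Γ).toCoxeterSystem

/-- A chamber system over `I`: a set `C` of chambers with one equivalence relation
(`i`-adjacency) for each `i` in `I`. -/
structure ChamberSystem (I : Type u) (C : Type v) where
  adj : I → Setoid C

namespace ChamberSystem

variable {I : Type u} {C : Type v}

/-- `S.Joined f c d`: there is a gallery of type `f` from `c` to `d`, that is, for
`f = i₁ ⋯ iₖ` there are chambers `c = c₀, c₁, …, cₖ = d` such that `cⱼ₋₁` and `cⱼ` are
distinct and `iⱼ`-adjacent. -/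
def Joined (S : ChamberSystem I C) : List I → C → C → Prop
  | [], c, d => c = d
  | i :: f, c, d => ∃ e : C, c ≠ e ∧ S.adj i c e ∧ Joined S f e d

/-- The `J`-residue that contains the chamber `c`. -/
def residue (S : ChamberSystem I C) (J : Set I) (c : C) : Set C :=
  {d | ∃ f : List I, (∀ i ∈ f, i ∈ J) ∧ S.Joined f c d}

/-- `R` is a residue of rank `1`, that is, an `{i}`-residue for some `i`. -/
def IsRankOneResidue (S : ChamberSystem I C) (R : Set C) : Prop :=
  ∃ (i : I) (c : C), R = S.residue {i} c

end ChamberSystem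

/-- A right-angled `Γ`-building with set of chambers `C`: a nonempty chamber system over the vertex
set of `Γ` in which each `i`-adjacency class has at least two chambers, with a `W(Γ)`-valued
distance `dist` such that, for each reduced word `f`, two chambers are joined by a gallery of type
`f` if and only if their distance is the element of `W(Γ)` represented by `f`. -/
structure Building {I : Type u} (Γ : SimpleGraph I) (C : Type v) extends ChamberSystem I C where
  nonempty : Nonempty C
  exists_adj : ∀ (i : I) (c : C), ∃ d : C, c ≠ d ∧ adj i c d
  dist : C → C → CoxGroup Γ
  joined_iff : ∀ f : List I, (coxSystem Γ).IsReduced f → ∀ c d : C,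
    toChamberSystem.Joined f c d ↔ dist c d = (coxSystem Γ).wordProd f

/-- An isomorphism of right-angled `Γ`-buildings: a bijection between the sets of chambers which
preserves and reflects `i`-adjacency for every vertex `i` of `Γ`, and preserves the
`W(Γ)`-distance. -/
structure Building.Iso {I : Type u} {Γ : SimpleGraph I} {C₁ : Type*} {C₂ : Type*}
    (B₁ : Building Γ C₁) (B₂ : Building Γ C₂) extends C₁ ≃ C₂ where
  map_adj : ∀ (i : I) (c d : C₁), B₁.adj i c d ↔ B₂.adj i (toFun c) (toFun d)
  map_dist : ∀ c d : C₁, B₂.dist (toFun c) (toFun d) = B₁.dist c d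

end RightAngled

/-! Fix a root chamber in each building. The chambers of a panel then split into its projection of
the root, the one chamber where the type is not a descent of the distance from the root, and
infinitely many others one step farther away. Each type `i` gets a colouring by `ℕ` that is
bijective on every `i`-panel, gives the projection colour `0`, and does not change across panels of
types adjacent to `i` (`exists_isColouring`). A chamber is then encoded by the types and colours met
along a gallery of increasing distance from the root, and chambers of the two buildings with a
common encoding are matched.

A chamber has many such galleries, so it must be shown that the matching does not depend on the
choice. If a chamber can be left towards the root through two different types, these types commute
(`adj_of_isRightDescent`) and span a rectangle, along whose parallel sides the colours agree. Hence
matching passes to projections onto panels (`Matches.gate`). This makes it a bijection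
(`Matches.right_unique`, `exists_matches`) that respects adjacency (`Matches.adj`), and therefore
distance (`dist_map`). -/

namespace RightAngled

universe u v

/-! ### Exchange condition and commuting descents in `W(Γ)`. -/

section CoxeterGroup

variable {I : Type u} (Γ : SimpleGraph I)

theorem coxeterMatrix_isLiftable {G : Type*} [Monoid G] {f : I → G} (hsq : ∀ i, f i * f i = 1)
    (hcomm : ∀ i j, Γ.Adj i j → f i * f j = f j * f i) : (coxeterMatrix Γ).IsLiftable f := by
  intro i j
  by_cases hij : i = j
  · subst hij
    simp [hsq]
  · by_cases h : Γ.Adj i j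
    · have : (coxeterMatrix Γ).M i j = 2 := by simp [coxeterMatrix, hij, h]
      rw [this, pow_two, mul_assoc, ← mul_assoc (f j), ← hcomm i j h, mul_assoc, hsq, mul_one, hsq]
    · have : (coxeterMatrix Γ).M i j = 0 := by simp [coxeterMatrix, hij, h]
      rw [this, pow_zero]

theorem simple_mul_comm {i j : I} (h : Γ.Adj i j) :
    (coxSystem Γ).simple i * (coxSystem Γ).simple j =
      (coxSystem Γ).simple j * (coxSystem Γ).simple i := by
  have hp := (coxSystem Γ).simple_mul_simple_pow i j
  have : (coxeterMatrix Γ).M i j = 2 := by simp [coxeterMatrix, h.ne, h]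
  rw [this, pow_two] at hp
  rw [eq_inv_of_mul_eq_one_left hp, mul_inv_rev, CoxeterSystem.inv_simple,
    CoxeterSystem.inv_simple]

open Classical in
/-- The character of `W(Γ)` that sends the generator `i` to `-1` and all others to `1`. -/
noncomputable def signHom (i : I) : CoxGroup Γ →* ℤˣ :=
  (coxSystem Γ).lift ⟨fun j => if j = i then -1 else 1,
    coxeterMatrix_isLiftable Γ (fun j => by split_ifs <;> simp) (fun j k _ => mul_comm _ _)⟩

open Classical in
theorem signHom_simple (i j : I) :
    signHom Γ i ((coxSystem Γ).simple j) = if j = i then -1 else 1 :=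
  (coxSystem Γ).lift_apply_simple _ j

theorem simple_injective : Function.Injective (coxSystem Γ).simple := by
  intro i j h
  have := congrArg (signHom Γ j) h
  rw [signHom_simple, signHom_simple] at this
  by_contra hij
  simp [hij] at this

open Classical in
/-- The action of a generator on pairs (element, parity), which counts inversions modulo `2`. -/
noncomputable def inversionStep (i : I) (p : CoxGroup Γ × ZMod 2) : CoxGroup Γ × ZMod 2 :=
  ((coxSystem Γ).simple i * p.1 * (coxSystem Γ).simple i,
    p.2 + if p.1 = (coxSystem Γ).simple i then 1 else 0)

theorem inversionStep_isLiftable : CoxeterMatrix.IsLiftable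
    (G := Function.End (CoxGroup Γ × ZMod 2)) (coxeterMatrix Γ) (inversionStep Γ) := by
  classical
  have hconj : ∀ i j : I, Γ.Adj i j → ∀ p : CoxGroup Γ × ZMod 2,
      (inversionStep Γ j p).1 = (coxSystem Γ).simple i ↔ p.1 = (coxSystem Γ).simple i := by
    rintro i j h ⟨t, ε⟩
    change (coxSystem Γ).simple j * t * (coxSystem Γ).simple j = (coxSystem Γ).simple i ↔
      t = (coxSystem Γ).simple i
    constructor
    · intro ht
      have := congrArg
        (fun x => (coxSystem Γ).simple j * x * (coxSystem Γ).simple j) ht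
      simp only [mul_assoc, (coxSystem Γ).simple_mul_simple_self, mul_one,
        (coxSystem Γ).simple_mul_simple_cancel_left] at this
      rw [this, simple_mul_comm Γ h, (coxSystem Γ).simple_mul_simple_cancel_left]
    · rintro rfl
      rw [simple_mul_comm Γ h.symm, (coxSystem Γ).simple_mul_simple_cancel_right]
  apply coxeterMatrix_isLiftable
  · intro i
    funext p
    change inversionStep Γ i (inversionStep Γ i p) = p
    have h2 : (1 : ZMod 2) + 1 = 0 := by decide
    have hiff : (inversionStep Γ i p).1 = (coxSystem Γ).simple i ↔
        p.1 = (coxSystem Γ).simple i := by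
      change (coxSystem Γ).simple i * p.1 * (coxSystem Γ).simple i = (coxSystem Γ).simple i ↔ _
      rw [mul_eq_right, mul_eq_one_iff_eq_inv', CoxeterSystem.inv_simple]
    ext
    · simp [inversionStep, mul_assoc, -CoxeterMatrix.toCoxeterSystem_simple]
    · change p.2 + (if p.1 = (coxSystem Γ).simple i then 1 else 0) +
        (if (inversionStep Γ i p).1 = (coxSystem Γ).simple i then 1 else 0) = p.2
      rw [if_congr hiff rfl rfl, add_assoc]
      split_ifs <;> simp [h2]
  · intro i j h
    funext p
    change inversionStep Γ i (inversionStep Γ j p) = inversionStep Γ j (inversionStep Γ i p)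
    ext
    · simp only [inversionStep]
      calc _ = ((coxSystem Γ).simple i * (coxSystem Γ).simple j) * p.1 *
            ((coxSystem Γ).simple j * (coxSystem Γ).simple i) := by simp only [mul_assoc]
        _ = ((coxSystem Γ).simple j * (coxSystem Γ).simple i) * p.1 *
            ((coxSystem Γ).simple i * (coxSystem Γ).simple j) := by rw [simple_mul_comm Γ h]
        _ = _ := by simp only [mul_assoc]
    · change p.2 + (if p.1 = (coxSystem Γ).simple j then 1 else 0) +
          (if (inversionStep Γ j p).1 = (coxSystem Γ).simple i then 1 else 0) =
        p.2 + (if p.1 = (coxSystem Γ).simple i then 1 else 0) +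
          (if (inversionStep Γ i p).1 = (coxSystem Γ).simple j then 1 else 0)
      rw [if_congr (hconj i j h p) rfl rfl, if_congr (hconj j i h.symm p) rfl rfl]
      ring

/-- The action of `W(Γ)` on pairs (element, parity). -/
noncomputable def inversionHom : CoxGroup Γ →* Function.End (CoxGroup Γ × ZMod 2) :=
  (coxSystem Γ).lift ⟨inversionStep Γ, inversionStep_isLiftable Γ⟩

open Classical in
-- The left side depends only on the group element, so the parity of the number of occurrences of
-- `t` in the right inversion sequence is the same for all words representing it.
theorem inversionHom_wordProd (ω : List I) (t : CoxGroup Γ) :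
    inversionHom Γ ((coxSystem Γ).wordProd ω) (t, 0) =
      ((coxSystem Γ).wordProd ω * t * ((coxSystem Γ).wordProd ω)⁻¹,
        (((coxSystem Γ).rightInvSeq ω).count t : ZMod 2)) := by
  induction ω with
  | nil => simp [Function.End.one_def]
  | cons i ω ih =>
    have hs : inversionHom Γ ((coxSystem Γ).simple i) = inversionStep Γ i :=
      (coxSystem Γ).lift_apply_simple _ i
    rw [CoxeterSystem.wordProd_cons, map_mul, hs]
    change inversionStep Γ i (inversionHom Γ ((coxSystem Γ).wordProd ω) (t, 0)) = _
    rw [ih]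
    ext
    · simp [inversionStep, mul_assoc, -CoxeterMatrix.toCoxeterSystem_simple]
    · simp only [inversionStep, CoxeterSystem.rightInvSeq, List.count_cons, beq_iff_eq,
        Nat.cast_add, Nat.cast_ite, Nat.cast_one, Nat.cast_zero]
      congr 2
      rw [eq_iff_iff]
      constructor
      · intro h
        rw [← h]
        group
      · intro h
        rw [← h]
        group

/-- The exchange condition for right descents. -/
theorem exists_eraseIdx_of_isRightDescent (ω : List I) (i : I)
    (h : (coxSystem Γ).IsRightDescent ((coxSystem Γ).wordProd ω) i) :
    ∃ k < ω.length, (coxSystem Γ).wordProd ω * (coxSystem Γ).simple i =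
      (coxSystem Γ).wordProd (ω.eraseIdx k) := by
  classical
  obtain ⟨ω', hω', hprod⟩ :=
    (coxSystem Γ).exists_isReduced ((coxSystem Γ).wordProd ω * (coxSystem Γ).simple i)
  have hω : (coxSystem Γ).wordProd ω = (coxSystem Γ).wordProd (ω'.concat i) := by
    rw [CoxeterSystem.wordProd_concat, ← hprod, CoxeterSystem.simple_mul_simple_cancel_right]
  have hred : (coxSystem Γ).IsReduced (ω'.concat i) := by
    rw [CoxeterSystem.IsReduced, ← hω, ← (CoxeterSystem.isRightDescent_iff _).1 h, hprod,
      hω'.eq, List.length_concat]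
  have hcount : ((coxSystem Γ).rightInvSeq (ω'.concat i)).count ((coxSystem Γ).simple i) = 1 :=
    List.count_eq_one_of_mem hred.nodup_rightInvSeq
      (by rw [CoxeterSystem.rightInvSeq_concat]; simp)
  -- This parity can be computed on the reduced word ending in `i`, whose inversion sequence has no
  -- repetitions and contains `simple i`.
  have hpar : (((coxSystem Γ).rightInvSeq ω).count ((coxSystem Γ).simple i) : ZMod 2) = 1 := by
    have := congrArg Prod.snd (inversionHom_wordProd Γ ω ((coxSystem Γ).simple i))
    rw [hω, inversionHom_wordProd, hcount] at this
    simpa using this.symm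
  have hmem : (coxSystem Γ).simple i ∈ (coxSystem Γ).rightInvSeq ω := by
    by_contra hn
    rw [List.count_eq_zero_of_not_mem hn] at hpar
    simp at hpar
  obtain ⟨k, hk, hki⟩ := List.mem_iff_getElem.mp hmem
  refine ⟨k, by simpa using hk, ?_⟩
  rw [← CoxeterSystem.wordProd_mul_getD_rightInvSeq, List.getD_eq_getElem _ 1 hk, hki]

open Classical in
/-- The reflections of the integers that `i` and `j` induce when all other generators are killed. -/
noncomputable def lineStep (i j k : I) : Function.End ℤ :=
  fun x => if k = i then -x else if k = j then 4 - x else x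

theorem lineStep_isLiftable {i j : I} (h : ¬ Γ.Adj i j) :
    (coxeterMatrix Γ).IsLiftable (lineStep i j) := by
  apply coxeterMatrix_isLiftable
  · intro k
    funext x
    change lineStep i j k (lineStep i j k x) = x
    unfold lineStep
    split_ifs <;> ring
  · intro k l hkl
    funext x
    change lineStep i j k (lineStep i j l x) = lineStep i j l (lineStep i j k x)
    unfold lineStep
    split_ifs <;> first | rfl | (subst_vars; exact absurd hkl h) |
      (subst_vars; exact absurd hkl.symm h)

/-- The action of `W(Γ)` on the integers through the infinite dihedral quotient. -/
noncomputable def lineHom {i j : I} (h : ¬ Γ.Adj i j) : CoxGroup Γ →* Function.End ℤ :=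
  (coxSystem Γ).lift ⟨lineStep i j, lineStep_isLiftable Γ h⟩

theorem lineHom_simple {i j : I} (h : ¬ Γ.Adj i j) (k : I) :
    lineHom Γ h ((coxSystem Γ).simple k) = lineStep i j k :=
  (coxSystem Γ).lift_apply_simple _ k

/-- Every letter acts as an isometry and moves the point `1` by at most `2`. -/
theorem abs_lineHom_wordProd_sub_le {i j : I} (h : ¬ Γ.Adj i j) (ω : List I) :
    |lineHom Γ h ((coxSystem Γ).wordProd ω) 1 - 1| ≤ 2 * ω.length := by
  have hiso : ∀ (k : I) (x y : ℤ), |lineStep i j k x - lineStep i j k y| = |x - y| := by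
    intro k x y
    unfold lineStep
    split_ifs
    · rw [abs_sub_comm x y]; ring_nf
    · rw [abs_sub_comm x y]; ring_nf
    · rfl
  have hmove : ∀ k : I, |lineStep i j k 1 - 1| ≤ 2 := by
    intro k
    unfold lineStep
    split_ifs <;> norm_num
  induction ω with
  | nil => simp [Function.End.one_def]
  | cons k ω ih =>
    rw [CoxeterSystem.wordProd_cons, map_mul, lineHom_simple]
    change |lineStep i j k (lineHom Γ h ((coxSystem Γ).wordProd ω) 1) - 1| ≤ _
    have h1 := abs_sub_le (lineStep i j k (lineHom Γ h ((coxSystem Γ).wordProd ω) 1))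
      (lineStep i j k 1) 1
    rw [hiso] at h1
    have h2 := hmove k
    push_cast [List.length_cons]
    linarith

/-- The reflections fix `0` and `2`, and `1` is the midpoint of the interval between them. Each
further letter of an alternating word carries it one interval farther, so the bound
`abs_lineHom_wordProd_sub_le` is attained. -/
theorem abs_lineHom_alternatingWord_sub {i j : I} (hij : i ≠ j) (h : ¬ Γ.Adj i j) (m : ℕ) :
    |lineHom Γ h ((coxSystem Γ).wordProd (CoxeterSystem.alternatingWord i j m)) 1 - 1| =
      2 * m := by
  have hi : ∀ x, lineStep i j i x = -x := fun x => by simp [lineStep]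
  have hj : ∀ x, lineStep i j j x = 4 - x := fun x => by simp [lineStep, hij.symm]
  have hpow : ∀ (p : ℕ) (x : ℤ), lineHom Γ h
      (((coxSystem Γ).simple i * (coxSystem Γ).simple j) ^ p) x = x - 4 * p := by
    intro p
    induction p with
    | zero => intro x; simp [Function.End.one_def]
    | succ p ih =>
      intro x
      rw [pow_succ, map_mul, map_mul, lineHom_simple, lineHom_simple]
      change lineHom Γ h _ (lineStep i j i (lineStep i j j x)) = _
      rw [ih, hi, hj]
      push_cast
      ring
  rw [CoxeterSystem.prod_alternatingWord_eq_mul_pow, map_mul]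
  change |lineHom Γ h _ (lineHom Γ h _ 1) - 1| = _
  rw [hpow]
  rcases Nat.even_or_odd' m with ⟨p, rfl | rfl⟩
  · have : 2 * p / 2 = p := by lia
    rw [this, if_pos (even_two_mul p), map_one]
    change |(1 - 4 * (p : ℤ)) - 1| = _
    rw [show (1 - 4 * (p : ℤ)) - 1 = -(4 * p) by ring, abs_neg, abs_of_nonneg (by positivity)]
    push_cast
    ring
  · have : (2 * p + 1) / 2 = p := by lia
    rw [this, if_neg (by simp), lineHom_simple, hj, abs_of_nonneg (by lia)]
    push_cast
    ring

/-- Two non-commuting descents would allow a reduced word to end in arbitrarily long alternating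
words, which is absurd once `n` exceeds the length of `w`. The induction swaps `i` and `j` and
applies the exchange condition to the new last letter. -/
theorem exists_alternatingWord_suffix (n : ℕ) {i j : I} (hij : i ≠ j) (h : ¬ Γ.Adj i j)
    {w : CoxGroup Γ} (hi : (coxSystem Γ).IsRightDescent w i)
    (hj : (coxSystem Γ).IsRightDescent w j) :
    ∃ ω : List I, w = (coxSystem Γ).wordProd (ω ++ CoxeterSystem.alternatingWord i j n) ∧
      (coxSystem Γ).length w = ω.length + n := by
  induction n generalizing i j with
  | zero =>
    obtain ⟨ω, hω, rfl⟩ := (coxSystem Γ).exists_isReduced w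
    exact ⟨ω, by simp [CoxeterSystem.alternatingWord], by simpa using hω.eq⟩
  | succ n ih =>
    have h' : ¬ Γ.Adj j i := fun hji => h hji.symm
    obtain ⟨ω, hw, hl⟩ := ih hij.symm h' hj hi
    have hj' := hj
    rw [hw] at hj'
    obtain ⟨k, hk, hke⟩ := exists_eraseIdx_of_isRightDescent Γ _ j hj'
    rw [List.length_append, CoxeterSystem.length_alternatingWord] at hk
    rcases lt_or_ge k ω.length with hkω | hkω
    · refine ⟨ω.eraseIdx k, ?_, ?_⟩
      · rw [List.eraseIdx_append_of_lt_length hkω] at hke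
        rw [CoxeterSystem.alternatingWord_succ, List.concat_eq_append, ← List.append_assoc,
          ← List.concat_eq_append, CoxeterSystem.wordProd_concat, ← hke,
          CoxeterSystem.simple_mul_simple_cancel_right, hw]
      · rw [hl, List.length_eraseIdx_of_lt hkω]
        lia
    -- If the deleted letter lay in the alternating suffix, an alternating word of length `n + 1`
    -- would equal a word of length at most `n`, against the displacement of `1`.
    · exfalso
      rw [List.eraseIdx_append_of_length_le hkω, CoxeterSystem.wordProd_append,
        CoxeterSystem.wordProd_append, mul_assoc, mul_right_inj, ← CoxeterSystem.wordProd_concat,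
        ← CoxeterSystem.alternatingWord_succ] at hke
      have h1 := abs_lineHom_alternatingWord_sub Γ hij h (n + 1)
      have h2 := abs_lineHom_wordProd_sub_le Γ h
        ((CoxeterSystem.alternatingWord j i n).eraseIdx (k - ω.length))
      have h3 := List.length_eraseIdx_le (CoxeterSystem.alternatingWord j i n) (k - ω.length)
      rw [CoxeterSystem.length_alternatingWord] at h3
      rw [hke] at h1
      push_cast at h1
      lia

theorem adj_of_isRightDescent {i j : I} (hij : i ≠ j) {w : CoxGroup Γ}
    (hi : (coxSystem Γ).IsRightDescent w i) (hj : (coxSystem Γ).IsRightDescent w j) :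
    Γ.Adj i j := by
  by_contra h
  obtain ⟨ω, -, hl⟩ := exists_alternatingWord_suffix Γ ((coxSystem Γ).length w + 1) hij h hi hj
  lia

/-- Apply the exchange condition for `i` to a reduced word ending in `j`. The deleted letter is not
the final `j`, since distinct generators are distinct elements, so the shortened word still ends in
`j`. -/
theorem isRightDescent_mul_simple {i j : I} (hij : i ≠ j) {w : CoxGroup Γ}
    (hi : (coxSystem Γ).IsRightDescent w i) (hj : (coxSystem Γ).IsRightDescent w j) :
    (coxSystem Γ).IsRightDescent (w * (coxSystem Γ).simple i) j := by
  obtain ⟨ω, hω, hprod⟩ := (coxSystem Γ).exists_isReduced (w * (coxSystem Γ).simple j)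
  have hw : w = (coxSystem Γ).wordProd (ω.concat j) := by
    rw [CoxeterSystem.wordProd_concat, ← hprod, CoxeterSystem.simple_mul_simple_cancel_right]
  have hi' := hi
  rw [hw] at hi'
  obtain ⟨k, hk, hke⟩ := exists_eraseIdx_of_isRightDescent Γ _ i hi'
  rw [List.length_concat] at hk
  rw [← hw, List.concat_eq_append] at hke
  have hli := (CoxeterSystem.isRightDescent_iff _).1 hi
  have hlj := (CoxeterSystem.isRightDescent_iff _).1 hj
  rw [hprod, hω.eq] at hlj
  rcases lt_or_ge k ω.length with hkω | hkω
  · rw [List.eraseIdx_append_of_lt_length hkω, ← List.concat_eq_append,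
      CoxeterSystem.wordProd_concat] at hke
    rw [CoxeterSystem.IsRightDescent, hke, CoxeterSystem.simple_mul_simple_cancel_right, ← hke]
    have := (coxSystem Γ).length_wordProd_le (ω.eraseIdx k)
    rw [List.length_eraseIdx_of_lt hkω] at this
    lia
  · have : k - ω.length = 0 := by lia
    rw [List.eraseIdx_append_of_length_le hkω, this, List.eraseIdx_zero, List.tail_cons,
      List.append_nil, ← hprod, mul_right_inj] at hke
    exact absurd (simple_injective Γ hke) hij

theorem isRightDescent_mul_simple_iff {i j : I} (h : Γ.Adj i j) (w : CoxGroup Γ) :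
    (coxSystem Γ).IsRightDescent (w * (coxSystem Γ).simple i) j ↔
      (coxSystem Γ).IsRightDescent w j := by
  have key : ∀ w : CoxGroup Γ, (coxSystem Γ).IsRightDescent w j →
      (coxSystem Γ).IsRightDescent (w * (coxSystem Γ).simple i) j := by
    intro w hj
    by_cases hi : (coxSystem Γ).IsRightDescent w i
    · exact isRightDescent_mul_simple Γ h.ne hi hj
    · have h1 := (CoxeterSystem.not_isRightDescent_iff _).1 hi
      have h2 := (CoxeterSystem.isRightDescent_iff _).1 hj
      have h3 := (coxSystem Γ).length_mul_simple (w * (coxSystem Γ).simple j) i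
      rw [CoxeterSystem.IsRightDescent, mul_assoc, simple_mul_comm Γ h, ← mul_assoc]
      lia
  refine ⟨fun hw => ?_, key w⟩
  simpa [-CoxeterMatrix.toCoxeterSystem_simple] using key _ hw

theorem isReduced_pair {i j : I} (h : i ≠ j) : (coxSystem Γ).IsReduced [i, j] := by
  have h1 := (coxSystem Γ).length_mul_simple ((coxSystem Γ).simple i) j
  rw [CoxeterSystem.length_simple] at h1
  rcases h1 with h1 | h1
  · simpa [CoxeterSystem.IsReduced, CoxeterSystem.wordProd_cons] using h1
  · have h0 : (coxSystem Γ).simple i * (coxSystem Γ).simple j = 1 := by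
      rw [← (coxSystem Γ).length_eq_zero_iff]
      lia
    have := eq_inv_of_mul_eq_one_left h0
    rw [CoxeterSystem.inv_simple] at this
    exact absurd (simple_injective Γ this) h

end CoxeterGroup

/-! ### Galleries and rank-one residues. -/

namespace ChamberSystem

variable {I : Type u} {C : Type v} (S : ChamberSystem I C)

theorem joined_append (f g : List I) (c d : C) :
    S.Joined (f ++ g) c d ↔ ∃ e, S.Joined f c e ∧ S.Joined g e d := by
  induction f generalizing c with
  | nil => simp [Joined]
  | cons i f ih =>
    simp only [List.cons_append, Joined, ih]
    constructor
    · rintro ⟨e, h1, h2, x, h3, h4⟩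
      exact ⟨x, ⟨e, h1, h2, h3⟩, h4⟩
    · rintro ⟨x, ⟨e, h1, h2, h3⟩, h4⟩
      exact ⟨e, h1, h2, x, h3, h4⟩

theorem joined_singleton (i : I) (c d : C) : S.Joined [i] c d ↔ c ≠ d ∧ S.adj i c d := by
  simp only [Joined]
  constructor
  · rintro ⟨e, h1, h2, rfl⟩
    exact ⟨h1, h2⟩
  · rintro ⟨h1, h2⟩
    exact ⟨d, h1, h2, rfl⟩

theorem joined_concat (f : List I) (i : I) (c d : C) :
    S.Joined (f.concat i) c d ↔ ∃ e, S.Joined f c e ∧ e ≠ d ∧ S.adj i e d := by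
  simp only [List.concat_eq_append, joined_append, joined_singleton]

theorem joined_map {C' : Type*} (S' : ChamberSystem I C') {φ : C → C'}
    (hφ : Function.Injective φ) (hadj : ∀ i c d, S.adj i c d → S'.adj i (φ c) (φ d))
    {f : List I} {c d : C} (h : S.Joined f c d) : S'.Joined f (φ c) (φ d) := by
  induction f generalizing c with
  | nil => exact congrArg φ h
  | cons i f ih =>
    obtain ⟨e, h1, h2, h3⟩ := h
    exact ⟨φ e, hφ.ne h1, hadj _ _ _ h2, ih h3⟩

theorem residue_singleton (i : I) (c : C) : S.residue {i} c = {d | S.adj i c d} := by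
  ext d
  constructor
  · rintro ⟨f, hf, h⟩
    induction f generalizing c with
    | nil => obtain rfl : c = d := h; exact (S.adj i).refl c
    | cons j f ih =>
      obtain ⟨e, -, h2, h3⟩ := h
      have hj : j = i := hf j (by simp)
      rw [hj] at h2
      exact (S.adj i).trans h2 (ih e (fun k hk => hf k (by simp [hk])) h3)
  · intro h
    by_cases hcd : c = d
    · exact ⟨[], by simp, hcd⟩
    · exact ⟨[i], by simp, (S.joined_singleton i c d).2 ⟨hcd, h⟩⟩

end ChamberSystem

/-! ### Projections onto panels. -/

namespace Building

variable {I : Type u} {Γ : SimpleGraph I} {C : Type v} (B : Building Γ C)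

theorem dist_eq_one_iff {c d : C} : B.dist c d = 1 ↔ c = d := by
  have := B.joined_iff [] (by simp [CoxeterSystem.IsReduced]) c d
  rw [CoxeterSystem.wordProd_nil] at this
  exact this.symm

theorem exists_joined (c d : C) : ∃ f : List I, (coxSystem Γ).IsReduced f ∧
    B.dist c d = (coxSystem Γ).wordProd f ∧ B.Joined f c d := by
  obtain ⟨f, hf, h⟩ := (coxSystem Γ).exists_isReduced (B.dist c d)
  exact ⟨f, hf, h, (B.joined_iff f hf c d).2 h⟩

/-- The gate of an `i`-panel: a descent can be undone inside the panel. -/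
theorem exists_gate {i : I} {a c : C} (h : (coxSystem Γ).IsRightDescent (B.dist a c) i) :
    ∃ g, g ≠ c ∧ B.adj i g c ∧ B.dist a g = B.dist a c * (coxSystem Γ).simple i := by
  obtain ⟨f, hf, hw⟩ :=
    (coxSystem Γ).exists_isReduced (B.dist a c * (coxSystem Γ).simple i)
  have hc : B.dist a c = (coxSystem Γ).wordProd (f.concat i) := by
    rw [CoxeterSystem.wordProd_concat, ← hw, CoxeterSystem.simple_mul_simple_cancel_right]
  have hred : (coxSystem Γ).IsReduced (f.concat i) := by
    rw [CoxeterSystem.IsReduced, ← hc, ← (CoxeterSystem.isRightDescent_iff _).1 h, hw, hf.eq,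
      List.length_concat]
  obtain ⟨g, h1, h2, h3⟩ := (B.joined_concat f i a c).1 ((B.joined_iff _ hred a c).2 hc)
  exact ⟨g, h2, h3, by rw [(B.joined_iff f hf a g).1 h1, hw]⟩

theorem dist_of_not_isRightDescent {i : I} {a c d : C} (hcd : c ≠ d) (hadj : B.adj i c d)
    (h : ¬ (coxSystem Γ).IsRightDescent (B.dist a c) i) :
    B.dist a d = B.dist a c * (coxSystem Γ).simple i := by
  obtain ⟨f, hf, hw, hj⟩ := B.exists_joined a c
  have hred : (coxSystem Γ).IsReduced (f.concat i) := by
    rw [CoxeterSystem.IsReduced, CoxeterSystem.wordProd_concat, ← hw,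
      (CoxeterSystem.not_isRightDescent_iff _).1 h, hw, hf.eq, List.length_concat]
  rw [hw, ← CoxeterSystem.wordProd_concat, ← B.joined_iff _ hred]
  exact (B.joined_concat f i a d).2 ⟨c, hj, hcd, hadj⟩

theorem isRightDescent_of_not_isRightDescent {i : I} {a c d : C} (hcd : c ≠ d)
    (hadj : B.adj i c d) (h : ¬ (coxSystem Γ).IsRightDescent (B.dist a c) i) :
    (coxSystem Γ).IsRightDescent (B.dist a d) i := by
  rw [B.dist_of_not_isRightDescent hcd hadj h]
  exact not_not.1 (mt ((CoxeterSystem.isRightDescent_iff_not_isRightDescent_mul _).2) h)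

theorem eq_of_not_isRightDescent {i : I} {a c d : C} (hadj : B.adj i c d)
    (hc : ¬ (coxSystem Γ).IsRightDescent (B.dist a c) i)
    (hd : ¬ (coxSystem Γ).IsRightDescent (B.dist a d) i) : c = d := by
  by_contra hcd
  exact hd (B.isRightDescent_of_not_isRightDescent hcd hadj hc)

/-- Together with `eq_of_not_isRightDescent`, this gives each panel a unique projection of `a`. -/
theorem exists_adj_not_isRightDescent (i : I) (a c : C) :
    ∃ g, B.adj i g c ∧ ¬ (coxSystem Γ).IsRightDescent (B.dist a g) i := by
  by_cases h : (coxSystem Γ).IsRightDescent (B.dist a c) i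
  · obtain ⟨g, -, h1, h2⟩ := B.exists_gate h
    refine ⟨g, h1, ?_⟩
    rw [h2]
    exact (CoxeterSystem.isRightDescent_iff_not_isRightDescent_mul _).1 h
  · exact ⟨c, (B.adj i).refl c, h⟩

theorem dist_of_adj {i : I} {c d : C} (a : C) (h : B.adj i c d) :
    B.dist a d = B.dist a c ∨ B.dist a d = B.dist a c * (coxSystem Γ).simple i := by
  obtain ⟨g, hg, hgi⟩ := B.exists_adj_not_isRightDescent i a c
  have key : ∀ x, B.adj i g x →
      x = g ∨ B.dist a x = B.dist a g * (coxSystem Γ).simple i := by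
    intro x hx
    by_cases hxg : g = x
    · exact Or.inl hxg.symm
    · exact Or.inr (B.dist_of_not_isRightDescent hxg hx hgi)
  rcases key c hg with rfl | hc <;> rcases key d ((B.adj i).trans hg h) with rfl | hd
  · exact Or.inl rfl
  · exact Or.inr hd
  · right
    rw [hc, CoxeterSystem.simple_mul_simple_cancel_right]
  · exact Or.inl (by rw [hc, hd])

theorem isRightDescent_iff_of_adj {i j : I} (hij : Γ.Adj i j) {c d : C} (a : C)
    (h : B.adj j c d) :
    (coxSystem Γ).IsRightDescent (B.dist a c) i ↔
      (coxSystem Γ).IsRightDescent (B.dist a d) i := by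
  rcases B.dist_of_adj a h with h | h
  · rw [h]
  · rw [h, isRightDescent_mul_simple_iff Γ hij.symm]

/-- Adjacent panels of commuting types span a rectangle. -/
theorem exists_rectangle {i j : I} (hij : Γ.Adj i j) {c d e : C} (h1 : B.adj i c d)
    (h2 : B.adj j d e) : ∃ d', B.adj j c d' ∧ B.adj i d' e := by
  by_cases hcd : c = d
  · subst hcd
    exact ⟨e, h2, (B.adj i).refl e⟩
  by_cases hde : d = e
  · subst hde
    exact ⟨c, (B.adj j).refl c, h1⟩
  have h : B.Joined [i, j] c e := ⟨d, hcd, h1, (B.joined_singleton j d e).2 ⟨hde, h2⟩⟩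
  rw [B.joined_iff _ (isReduced_pair Γ hij.ne)] at h
  have h' : B.dist c e = (coxSystem Γ).wordProd [j, i] := by
    rw [h, CoxeterSystem.wordProd_cons, CoxeterSystem.wordProd_singleton,
      CoxeterSystem.wordProd_cons, CoxeterSystem.wordProd_singleton, simple_mul_comm Γ hij]
  rw [← B.joined_iff _ (isReduced_pair Γ hij.ne')] at h'
  obtain ⟨d', -, h3, h4⟩ := h'
  exact ⟨d', h3, ((B.joined_singleton i d' e).1 h4).2⟩

/-! ### Parallelism of panels. -/

/-- Two chambers are `i`-parallel if they lie in a common residue whose type consists of the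
vertices adjacent to `i`. -/
def parallel (i : I) : Setoid C :=
  Relation.EqvGen.setoid fun c d => ∃ j, Γ.Adj i j ∧ B.adj j c d

theorem parallel_of_adj {i j : I} (hij : Γ.Adj i j) {c d : C} (h : B.adj j c d) :
    B.parallel i c d :=
  Relation.EqvGen.rel _ _ ⟨j, hij, h⟩

theorem isRightDescent_iff_of_parallel {i : I} {c d : C} (a : C) (h : B.parallel i c d) :
    (coxSystem Γ).IsRightDescent (B.dist a c) i ↔
      (coxSystem Γ).IsRightDescent (B.dist a d) i := by
  induction (h : Relation.EqvGen _ c d) with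
  | rel x y hxy =>
    obtain ⟨j, hij, hxy⟩ := hxy
    exact B.isRightDescent_iff_of_adj hij a hxy
  | refl => rfl
  | symm x y h ih => exact ih.symm
  | trans x y z h1 h2 ih1 ih2 => exact ih1.trans ih2

/-- Parallel moves use only types adjacent to `i`, hence different from `i`, and `signHom Γ i` is
trivial on those generators. -/
theorem signHom_dist_of_parallel {i : I} {c d : C} (a : C) (h : B.parallel i c d) :
    signHom Γ i (B.dist a c) = signHom Γ i (B.dist a d) := by
  induction (h : Relation.EqvGen _ c d) with
  | rel x y hxy =>
    obtain ⟨j, hij, hxy⟩ := hxy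
    rcases B.dist_of_adj a hxy with h | h
    · rw [h]
    · rw [h, map_mul, signHom_simple, if_neg hij.ne', mul_one]
  | refl => rfl
  | symm x y h ih => exact ih.symm
  | trans x y z h1 h2 ih1 ih2 => exact ih1.trans ih2

theorem eq_of_adj_of_parallel {i : I} {c d : C} (h1 : B.adj i c d) (h2 : B.parallel i c d) :
    c = d := by
  have h := B.signHom_dist_of_parallel c h2
  have hcc : B.dist c c = 1 := B.dist_eq_one_iff.2 rfl
  rcases B.dist_of_adj c h1 with h' | h'
  · rwa [hcc, B.dist_eq_one_iff] at h'
  · rw [h', hcc, one_mul, map_one, signHom_simple, if_pos rfl] at h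
    exact absurd h (by decide)

/-- Rectangles are glued along the chain of moves from `c` to `d`, transporting the `i`-panel of `c`
to that of `d`. -/
theorem exists_parallel_adj {i : I} {c d e : C} (h1 : B.parallel i c d) (h2 : B.adj i c e) :
    ∃ e', B.parallel i e e' ∧ B.adj i d e' := by
  -- Both directions are proved together so that the symmetry case of the induction closes.
  have key : ∀ x y, Relation.EqvGen (fun c d => ∃ j, Γ.Adj i j ∧ B.adj j c d) x y →
      (∀ e, B.adj i x e → ∃ e', B.parallel i e e' ∧ B.adj i y e') ∧
      (∀ e, B.adj i y e → ∃ e', B.parallel i e e' ∧ B.adj i x e') := by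
    intro x y h
    induction h with
    | rel x y hxy =>
      obtain ⟨j, hij, hxy⟩ := hxy
      constructor
      · intro e he
        obtain ⟨e', h3, h4⟩ := B.exists_rectangle hij ((B.adj i).symm he) hxy
        exact ⟨e', B.parallel_of_adj hij h3, (B.adj i).symm h4⟩
      · intro e he
        obtain ⟨e', h3, h4⟩ :=
          B.exists_rectangle hij ((B.adj i).symm he) ((B.adj j).symm hxy)
        exact ⟨e', B.parallel_of_adj hij h3, (B.adj i).symm h4⟩
    | refl x => exact ⟨fun e he => ⟨e, (B.parallel i).refl e, he⟩,
        fun e he => ⟨e, (B.parallel i).refl e, he⟩⟩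
    | symm x y h ih => exact ih.symm
    | trans x y z h1 h2 ih1 ih2 =>
      constructor
      · intro e he
        obtain ⟨e', h3, h4⟩ := ih1.1 e he
        obtain ⟨e'', h5, h6⟩ := ih2.1 e' h4
        exact ⟨e'', (B.parallel i).trans h3 h5, h6⟩
      · intro e he
        obtain ⟨e', h3, h4⟩ := ih2.2 e he
        obtain ⟨e'', h5, h6⟩ := ih1.2 e' h4
        exact ⟨e'', (B.parallel i).trans h3 h5, h6⟩
  exact (key c d h1).1 e h2

/-- The residue of the vertex `i` together with the vertices adjacent to it: some chamber is
`i`-adjacent to the first chamber and `i`-parallel to the second. -/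
def starResidue (i : I) : Setoid C where
  r c d := ∃ e, B.adj i c e ∧ B.parallel i e d
  iseqv :=
    { refl := fun c => ⟨c, (B.adj i).refl c, (B.parallel i).refl c⟩
      symm := by
        rintro c d ⟨e, h1, h2⟩
        obtain ⟨e', h3, h4⟩ := B.exists_parallel_adj h2 ((B.adj i).symm h1)
        exact ⟨e', h4, (B.parallel i).symm h3⟩
      trans := by
        rintro c d x ⟨e, h1, h2⟩ ⟨y, h3, h4⟩
        obtain ⟨e', h5, h6⟩ := B.exists_parallel_adj ((B.parallel i).symm h2) h3
        exact ⟨e', (B.adj i).trans h1 h6, (B.parallel i).trans ((B.parallel i).symm h5) h4⟩ }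

/-! ### Construction of the colourings. -/

/-- A colouring of the chambers, rooted at `c₀`: on each panel it is a bijection onto `ℕ` that
sends the projection of `c₀` to `0`, and parallel chambers have the same colour. -/
structure IsColouring (c₀ : C) (h : I → C → ℕ) : Prop where
  exists_adj : ∀ i c n, ∃ d, B.adj i c d ∧ h i d = n
  eq_of_adj : ∀ i c d, B.adj i c d → h i c = h i d → c = d
  eq_zero_iff : ∀ i c, h i c = 0 ↔ ¬ (coxSystem Γ).IsRightDescent (B.dist c₀ c) i
  colour_eq : ∀ i j c d, Γ.Adj i j → B.adj j c d → h i c = h i d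

theorem exists_panel_colouring (c₀ r : C) (i : I)
    (hB : {d | B.adj i r d}.Countable ∧ {d | B.adj i r d}.Infinite) :
    ∃ β : C → ℕ, (∀ n, ∃ d, B.adj i r d ∧ β d = n) ∧
      (∀ c d, B.adj i r c → B.adj i r d → β c = β d → c = d) ∧
      ∀ c, B.adj i r c →
        (β c = 0 ↔ ¬ (coxSystem Γ).IsRightDescent (B.dist c₀ c) i) := by
  classical
  have := hB.1.to_subtype
  have := hB.2.to_subtype
  obtain ⟨_⟩ := nonempty_denumerable {d | B.adj i r d}
  let eqv := Denumerable.eqv {d | B.adj i r d}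
  obtain ⟨g, hg, hgi⟩ := B.exists_adj_not_isRightDescent i c₀ r
  have hrg : B.adj i r g := (B.adj i).symm hg
  -- The transposition moves the projection `g` to `0`; the value off the panel below plays no role.
  let σ := eqv.trans (Equiv.swap (eqv ⟨g, hrg⟩) 0)
  have hσg : σ ⟨g, hrg⟩ = 0 := by simp [σ]
  have hval : ∀ d (hd : B.adj i r d),
      (fun d => if hd : B.adj i r d then σ ⟨d, hd⟩ else 0) d = σ ⟨d, hd⟩ :=
    fun d hd => dif_pos hd
  refine ⟨fun d => if hd : B.adj i r d then σ ⟨d, hd⟩ else 0, ?_, ?_, ?_⟩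
  · intro n
    refine ⟨(σ.symm n).1, (σ.symm n).2, ?_⟩
    rw [hval _ (σ.symm n).2]
    exact σ.apply_symm_apply n
  · intro c d hc hd h
    rw [hval c hc, hval d hd] at h
    exact congrArg Subtype.val (σ.injective h)
  · intro c hc
    rw [hval c hc]
    constructor
    · intro h
      have : c = g := congrArg Subtype.val (σ.injective (h.trans hσg.symm))
      rwa [this]
    · intro h
      have : g = c := B.eq_of_not_isRightDescent ((B.adj i).trans hg hc) hgi h
      subst this
      exact hσg

/-- One panel is coloured in each star residue and its colours are spread along parallelism. This is
well defined because a chamber has exactly one parallel in that panel. -/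
theorem exists_colouring_of_type (c₀ : C) (i : I)
    (hB : ∀ r, {d | B.adj i r d}.Countable ∧ {d | B.adj i r d}.Infinite) :
    ∃ h : C → ℕ, (∀ c n, ∃ d, B.adj i c d ∧ h d = n) ∧
      (∀ c d, B.adj i c d → h c = h d → c = d) ∧
      (∀ c, h c = 0 ↔ ¬ (coxSystem Γ).IsRightDescent (B.dist c₀ c) i) ∧
      ∀ j c d, Γ.Adj i j → B.adj j c d → h c = h d := by
  choose β hsurj hinj hzero using fun r => B.exists_panel_colouring c₀ r i (hB r)
  -- `q c` represents the star residue of `c`, and `e c` below is the chamber of the `i`-panel of `q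
  -- c` parallel to `c`.
  let q : C → C := fun c => (Quotient.mk (B.starResidue i) c).out
  have hq : ∀ c, ∃ e, B.adj i (q c) e ∧ B.parallel i e c :=
    fun c => Quotient.exact (Quotient.out_eq (Quotient.mk (B.starResidue i) c))
  have hq_eq : ∀ c d, B.starResidue i c d → q c = q d :=
    fun c d h => congrArg Quotient.out (Quotient.sound h)
  choose e he hec using hq
  have hqadj : ∀ c d, B.adj i c d → q c = q d :=
    fun c d h => hq_eq c d ⟨d, h, (B.parallel i).refl d⟩
  have he_eq : ∀ c x, B.adj i (q c) x → B.parallel i x c → e c = x := fun c x h1 h2 =>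
    B.eq_of_adj_of_parallel ((B.adj i).trans ((B.adj i).symm (he c)) h1)
      ((B.parallel i).trans (hec c) ((B.parallel i).symm h2))
  refine ⟨fun c => β (q c) (e c), ?_, ?_, ?_, ?_⟩
  · intro c n
    obtain ⟨x, hx, hxn⟩ := hsurj (q c) n
    obtain ⟨d, hd1, hd2⟩ :=
      B.exists_parallel_adj (hec c) ((B.adj i).trans ((B.adj i).symm (he c)) hx)
    refine ⟨d, hd2, ?_⟩
    have hqd := hqadj c d hd2
    change β (q d) (e d) = n
    rw [he_eq d x (hqd ▸ hx) hd1, ← hqd, hxn]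
  · intro c d hcd h
    have hqd := hqadj c d hcd
    change β (q c) (e c) = β (q d) (e d) at h
    rw [← hqd] at h
    have h1 := hinj (q c) _ _ (he c) (hqd ▸ he d) h
    refine B.eq_of_adj_of_parallel hcd ((B.parallel i).trans ((B.parallel i).symm (hec c)) ?_)
    rw [h1]
    exact hec d
  · intro c
    change β (q c) (e c) = 0 ↔ _
    rw [hzero (q c) (e c) (he c), B.isRightDescent_iff_of_parallel c₀ (hec c)]
  · intro j c d hij hcd
    have hpar := B.parallel_of_adj hij hcd
    have hqd : q c = q d := hq_eq c d ⟨c, (B.adj i).refl c, hpar⟩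
    change β (q c) (e c) = β (q d) (e d)
    rw [he_eq d (e c) (hqd ▸ he c) ((B.parallel i).trans (hec c) hpar), hqd]

theorem exists_isColouring (c₀ : C)
    (hB : ∀ R : Set C, B.IsRankOneResidue R → R.Countable ∧ R.Infinite) :
    ∃ h, B.IsColouring c₀ h := by
  have hB' : ∀ i r, {d | B.adj i r d}.Countable ∧ {d | B.adj i r d}.Infinite := by
    intro i r
    rw [← ChamberSystem.residue_singleton]
    exact hB _ ⟨i, r, rfl⟩
  choose h h1 h2 h3 h4 using fun i => B.exists_colouring_of_type c₀ i (hB' i)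
  exact ⟨h, h1, h2, h3, h4⟩

/-! ### Matching two coloured buildings. -/

section Matching

variable {C₁ C₂ : Type*} (B₁ : Building Γ C₁) (B₂ : Building Γ C₂)

/-- The chambers of two rooted coloured buildings that are reached from the roots by galleries
with the same types and colours, moving away from the roots. -/
inductive Matches (a₁ : C₁) (a₂ : C₂) (h₁ : I → C₁ → ℕ) (h₂ : I → C₂ → ℕ) : C₁ → C₂ → Prop
  | base : Matches a₁ a₂ h₁ h₂ a₁ a₂
  | step (i : I) (c d : C₁) (c' d' : C₂) : Matches a₁ a₂ h₁ h₂ c c' → B₁.adj i c d →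
      B₂.adj i c' d' → h₁ i c = 0 → h₂ i c' = 0 → h₁ i d ≠ 0 → h₁ i d = h₂ i d' →
      Matches a₁ a₂ h₁ h₂ d d'

variable {B₁ B₂} {a₁ : C₁} {a₂ : C₂} {h₁ : I → C₁ → ℕ} {h₂ : I → C₂ → ℕ}

theorem Matches.symm {c : C₁} {c' : C₂} (h : Matches B₁ B₂ a₁ a₂ h₁ h₂ c c') :
    Matches B₂ B₁ a₂ a₁ h₂ h₁ c' c := by
  induction h with
  | base => exact .base
  | step i c d c' d' _ h1 h2 h3 h4 h5 h6 ih =>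
    exact .step i c' d' c d ih h2 h1 h4 h3 (h6 ▸ h5) h6.symm

theorem IsColouring.dist_of_adj (H : B₁.IsColouring a₁ h₁) {i : I} {c d : C₁}
    (hcd : B₁.adj i c d) (hc : h₁ i c = 0) (hd : h₁ i d ≠ 0) :
    B₁.dist a₁ d = B₁.dist a₁ c * (coxSystem Γ).simple i := by
  refine B₁.dist_of_not_isRightDescent ?_ hcd ((H.eq_zero_iff i c).1 hc)
  rintro rfl
  exact hd hc

theorem Matches.dist_eq (H₁ : B₁.IsColouring a₁ h₁) (H₂ : B₂.IsColouring a₂ h₂) {c : C₁}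
    {c' : C₂} (h : Matches B₁ B₂ a₁ a₂ h₁ h₂ c c') : B₁.dist a₁ c = B₂.dist a₂ c' := by
  induction h with
  | base => rw [B₁.dist_eq_one_iff.2 rfl, B₂.dist_eq_one_iff.2 rfl]
  | step i c d c' d' _ h1 h2 h3 h4 h5 h6 ih =>
    rw [H₁.dist_of_adj h1 h3 h5, H₂.dist_of_adj h2 h4 (h6 ▸ h5), ih]

theorem Matches.colour_eq_zero_iff (H₁ : B₁.IsColouring a₁ h₁) (H₂ : B₂.IsColouring a₂ h₂)
    {c : C₁} {c' : C₂} (h : Matches B₁ B₂ a₁ a₂ h₁ h₂ c c') (i : I) :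
    h₁ i c = 0 ↔ h₂ i c' = 0 := by
  rw [H₁.eq_zero_iff, H₂.eq_zero_iff, h.dist_eq H₁ H₂]

/-- This makes the matching independent of the gallery: whichever panel is used to step back to the
root, the projections match and the colours agree. The induction follows the last step of the given
gallery, of type `j`; only the case where `i` and `j` are distinct descents needs the rectangle. -/
theorem Matches.gate (H₁ : B₁.IsColouring a₁ h₁) (H₂ : B₂.IsColouring a₂ h₂)
    {c : C₁} {c' : C₂} (h : Matches B₁ B₂ a₁ a₂ h₁ h₂ c c') {i : I} {g : C₁} {g' : C₂}
    (hg : B₁.adj i g c) (hg' : B₂.adj i g' c') (hg0 : h₁ i g = 0) (hg0' : h₂ i g' = 0) :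
    Matches B₁ B₂ a₁ a₂ h₁ h₂ g g' ∧ h₁ i c = h₂ i c' := by
  have hascent : ∀ {c c'}, Matches B₁ B₂ a₁ a₂ h₁ h₂ c c' → h₁ i c = 0 →
      ∀ {g g'}, B₁.adj i g c → B₂.adj i g' c' → h₁ i g = 0 → h₂ i g' = 0 →
      Matches B₁ B₂ a₁ a₂ h₁ h₂ g g' ∧ h₁ i c = h₂ i c' := by
    intro c c' h hc g g' hg hg' hg0 hg0'
    have hc' := (h.colour_eq_zero_iff H₁ H₂ i).1 hc
    rw [H₁.eq_of_adj i g c hg (hg0.trans hc.symm), H₂.eq_of_adj i g' c' hg' (hg0'.trans hc'.symm)]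
    exact ⟨h, hc.trans hc'.symm⟩
  induction h generalizing g g' with
  | base =>
    refine hascent .base ?_ hg hg' hg0 hg0'
    rw [H₁.eq_zero_iff, B₁.dist_eq_one_iff.2 rfl]
    exact (coxSystem Γ).not_isRightDescent_one i
  | step j e c e' c' hee h1 h2 h3 h4 h5 h6 ih =>
    have hcc := Matches.step j e c e' c' hee h1 h2 h3 h4 h5 h6
    by_cases hc0 : h₁ i c = 0
    · exact hascent hcc hc0 hg hg' hg0 hg0'
    by_cases hij : i = j
    · subst hij
      have hge : g = e := H₁.eq_of_adj i g e ((B₁.adj i).trans hg ((B₁.adj i).symm h1))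
        (hg0.trans h3.symm)
      have hge' : g' = e' := H₂.eq_of_adj i g' e' ((B₂.adj i).trans hg' ((B₂.adj i).symm h2))
        (hg0'.trans h4.symm)
      rw [hge, hge']
      exact ⟨hee, h6⟩
    have hadj : Γ.Adj i j := by
      refine adj_of_isRightDescent Γ hij (w := B₁.dist a₁ c) ?_ ?_
      · exact not_not.1 (mt (H₁.eq_zero_iff i c).2 hc0)
      · exact not_not.1 (mt (H₁.eq_zero_iff j c).2 h5)
    -- The projections of `e` and `e'` match by induction. In the rectangle `e`, `c`, `g`, `x`, the
    -- side from `x` to `g` is a step of type `j` with the same colours as the side from `e` to `c`.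
    obtain ⟨x, hx, hx0⟩ := H₁.exists_adj i e 0
    obtain ⟨x', hx', hx0'⟩ := H₂.exists_adj i e' 0
    obtain ⟨hxx, hcol⟩ := ih ((B₁.adj i).symm hx) ((B₂.adj i).symm hx') hx0 hx0'
    have hxg : B₁.adj j x g := by
      obtain ⟨y, hy1, hy2⟩ := B₁.exists_rectangle hadj ((B₁.adj i).symm hx) h1
      have hy0 : h₁ i y = 0 := (H₁.colour_eq i j x y hadj hy1).symm.trans hx0
      rwa [H₁.eq_of_adj i g y ((B₁.adj i).trans hg ((B₁.adj i).symm hy2)) (hg0.trans hy0.symm)]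
    have hxg' : B₂.adj j x' g' := by
      obtain ⟨y, hy1, hy2⟩ := B₂.exists_rectangle hadj ((B₂.adj i).symm hx') h2
      have hy0 : h₂ i y = 0 := (H₂.colour_eq i j x' y hadj hy1).symm.trans hx0'
      rwa [H₂.eq_of_adj i g' y ((B₂.adj i).trans hg' ((B₂.adj i).symm hy2))
        (hg0'.trans hy0.symm)]
    have hgj : h₁ j g = h₁ j c := H₁.colour_eq j i g c hadj.symm hg
    have hgj' : h₂ j g' = h₂ j c' := H₂.colour_eq j i g' c' hadj.symm hg'
    refine ⟨.step j x g x' g' hxx hxg hxg' ?_ ?_ ?_ ?_, ?_⟩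
    · rw [← H₁.colour_eq j i e x hadj.symm hx, h3]
    · rw [← H₂.colour_eq j i e' x' hadj.symm hx', h4]
    · rwa [hgj]
    · rw [hgj, hgj', h6]
    · rw [← H₁.colour_eq i j e c hadj h1, hcol, H₂.colour_eq i j e' c' hadj h2]

/-- By `Matches.gate`, the projection of `c''` matches `e`, so it is `e'` by induction; the colour
then singles out the chamber in its panel. -/
theorem Matches.right_unique (H₁ : B₁.IsColouring a₁ h₁) (H₂ : B₂.IsColouring a₂ h₂)
    {c : C₁} {c' c'' : C₂} (h' : Matches B₁ B₂ a₁ a₂ h₁ h₂ c c')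
    (h'' : Matches B₁ B₂ a₁ a₂ h₁ h₂ c c'') : c' = c'' := by
  induction h' generalizing c'' with
  | base =>
    have := h''.dist_eq H₁ H₂
    rw [B₁.dist_eq_one_iff.2 rfl] at this
    exact B₂.dist_eq_one_iff.1 this.symm
  | step i e c e' c' _ h1 h2 h3 h4 _ h6 ih =>
    obtain ⟨g, hg, hg0⟩ := H₂.exists_adj i c'' 0
    obtain ⟨heg, hcol⟩ := h''.gate H₁ H₂ h1 ((B₂.adj i).symm hg) h3 hg0
    obtain rfl := ih heg
    exact H₂.eq_of_adj i c' c'' ((B₂.adj i).trans ((B₂.adj i).symm h2) ((B₂.adj i).symm hg))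
      (h6.symm.trans hcol)

theorem exists_matches (H₁ : B₁.IsColouring a₁ h₁) (H₂ : B₂.IsColouring a₂ h₂) (c : C₁) :
    ∃ c', Matches B₁ B₂ a₁ a₂ h₁ h₂ c c' := by
  induction hn : (coxSystem Γ).length (B₁.dist a₁ c) using Nat.strong_induction_on
    generalizing c with
  | h n ih =>
    by_cases hc : B₁.dist a₁ c = 1
    · rw [B₁.dist_eq_one_iff] at hc
      subst hc
      exact ⟨a₂, .base⟩
    obtain ⟨i, hi⟩ := (coxSystem Γ).exists_rightDescent_of_ne_one hc
    obtain ⟨g, hgc, hg, hw⟩ := B₁.exists_gate hi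
    obtain ⟨g', hgg⟩ := ih _ (by rw [← hn, hw]; exact hi) g rfl
    have hg0 : h₁ i g = 0 := by
      rw [H₁.eq_zero_iff, hw]
      exact (CoxeterSystem.isRightDescent_iff_not_isRightDescent_mul _).1 hi
    obtain ⟨c', hc', hcol⟩ := H₂.exists_adj i g' (h₁ i c)
    exact ⟨c', .step i g c g' c' hgg hg hc' hg0 ((hgg.colour_eq_zero_iff H₁ H₂ i).1 hg0)
      (fun h0 => (H₁.eq_zero_iff i c).1 h0 hi) hcol.symm⟩

/-- Chambers `c` and `d` in one panel share the projection `g`. The projections of `c'` and `d'`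
both match `g`, so they coincide. -/
theorem Matches.adj (H₁ : B₁.IsColouring a₁ h₁) (H₂ : B₂.IsColouring a₂ h₂) {i : I}
    {c d : C₁} {c' d' : C₂} (hc : Matches B₁ B₂ a₁ a₂ h₁ h₂ c c')
    (hd : Matches B₁ B₂ a₁ a₂ h₁ h₂ d d') (h : B₁.adj i c d) : B₂.adj i c' d' := by
  obtain ⟨g, hg, hg0⟩ := H₁.exists_adj i c 0
  obtain ⟨x, hx, hx0⟩ := H₂.exists_adj i c' 0
  obtain ⟨y, hy, hy0⟩ := H₂.exists_adj i d' 0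
  have h1 := (hc.gate H₁ H₂ ((B₁.adj i).symm hg) ((B₂.adj i).symm hx) hg0 hx0).1
  have h2 := (hd.gate H₁ H₂ ((B₁.adj i).trans ((B₁.adj i).symm hg) h)
    ((B₂.adj i).symm hy) hg0 hy0).1
  rw [h1.right_unique H₁ H₂ h2] at hx
  exact (B₂.adj i).trans hx ((B₂.adj i).symm hy)

end Matching

/-- A bijection that preserves and reflects adjacency preserves the distance. -/
theorem dist_map {C' : Type*} (B' : Building Γ C') (φ : C ≃ C')
    (hφ : ∀ i c d, B.adj i c d → B'.adj i (φ c) (φ d)) (c d : C) :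
    B'.dist (φ c) (φ d) = B.dist c d := by
  obtain ⟨f, hf, hw, hj⟩ := B.exists_joined c d
  rw [hw, ← B'.joined_iff f hf]
  exact B.joined_map B'.toChamberSystem φ.injective hφ hj

end Building
end RightAngled

theorem mainTheorem8 {I : Type*} [Finite I] (Γ : SimpleGraph I) {C₁ : Type*} {C₂ : Type*}
    (B₁ : RightAngled.Building Γ C₁) (B₂ : RightAngled.Building Γ C₂)
    (h₁ : ∀ R : Set C₁, B₁.IsRankOneResidue R → R.Countable ∧ R.Infinite)
    (h₂ : ∀ R : Set C₂, B₂.IsRankOneResidue R → R.Countable ∧ R.Infinite) :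
    Nonempty (RightAngled.Building.Iso B₁ B₂) := by
  obtain ⟨a₁⟩ := B₁.nonempty
  obtain ⟨a₂⟩ := B₂.nonempty
  obtain ⟨k₁, H₁⟩ := B₁.exists_isColouring a₁ h₁
  obtain ⟨k₂, H₂⟩ := B₂.exists_isColouring a₂ h₂
  choose φ hφ using RightAngled.Building.exists_matches H₁ H₂
  choose ψ hψ using RightAngled.Building.exists_matches H₂ H₁
  let e : C₁ ≃ C₂ :=
    { toFun := φ
      invFun := ψ
      left_inv := fun c => (hψ (φ c)).right_unique H₂ H₁ (hφ c).symm
      right_inv := fun c => (hφ (ψ c)).right_unique H₁ H₂ (hψ c).symm }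
  exact ⟨{ e with
    map_adj := fun i c d => ⟨fun h => (hφ c).adj H₁ H₂ (hφ d) h,
      fun h => (hφ c).symm.adj H₂ H₁ (hφ d).symm h⟩
    map_dist := B₁.dist_map B₂ e fun i c d h => (hφ c).adj H₁ H₂ (hφ d) h }⟩
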